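/- Let $d\in\mathbb N$. Throughout, $\varepsilon>0$ and $z=(q,p)\in\mathbb R^{2d}$. For $\psi\in L^2(\mathbb R^d)$ let $$\mathcal W_\psi(z)=(2\pi\varepsilon)^{-d}\int_{\mathbb R^d}\overline{\psi}(q+\tfrac y2)\,\psi(q-\tfrac y2)\,e^{iy\cdot p/\varepsilon}\,dy$$ be its ($\varepsilon$-scaled) Wigner function, let $g_0(x)=(\pi\varepsilon)^{-d/4}e^{-|x|^2/(2\varepsilon)}$, let $\mathcal H_\psi=\mathcal W_\psi*\mathcal W_{g_0}$ (convolution on $\mathbb R^{2d}$) be the Husimi function of $\psi$, and let $$\mu_\psi=\mathcal H_\psi-\tfrac{\varepsilon}{4}\,\Delta\mathcal H_\psi ,$$ where $\Delta$ is the Laplacian on $\mathbb R^{2d}$. For a Schwartz function $a:\mathbb R^{2d}\to\mathbb R$ let $$(\operatorname{op}(a)\psi)(q)=(2\pi\varepsilon)^{-d}\int_{\mathbb R^{2d}}a(\tfrac{q+y}{2},p)\,\psi(y)\,e^{i(q-y)\cdot p/\varepsilon}\,dy\,dp$$ be its $\varepsilon$-scaled Weyl quantization. There are $K\ge 0$ and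 $M\in\mathbb N$, depending only on $d$, such that the following holds. For every Schwartz function $a:\mathbb R^{2d}\to\mathbb R$ there is a constant $C$ with $$0\le C\le K\sum_{k=4}^{M}\int_{\mathbb R^{2d}}\|D^k a(z)\|\,dz$$ (so $C$ depends only on $d$ and on derivatives of $a$ of order four and higher, and not on $\varepsilon$ or $\psi$) such that for all $\varepsilon>0$ and all $\psi\in L^2(\mathbb R^d)$: the function $\mathcal H_\psi$ is smooth, $a\,\mu_\psi$ is integrable, $\operatorname{op}(a)\psi\in L^2(\mathbb R^d)$, and $$\left|\langle\psi,\operatorname{op}(a)\psi\rangle-\int_{\mathbb R^{2d}}a(z)\,\mu_\psi(z)\,dz\right|\le C\,\varepsilon^2\,\|\psi\|^2 .$$ -/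

import Mathlib

open MeasureTheory
open scoped SchwartzMap ContDiff

noncomputable section

namespace PhaseSpace

/-- Configuration space `ℝ^d` with its Euclidean norm. -/
abbrev Config (d : ℕ) : Type := EuclideanSpace ℝ (Fin d)

/-- Phase space `ℝ^{2d}`, whose points are `z = (q, p)`, with the Euclidean norm
`|z|² = |q|² + |p|²` and Lebesgue measure. -/
abbrev Phase (d : ℕ) : Type := WithLp 2 (Config d × Config d)

/-- The integral
`(2πε)^{-d} ∫ conj (ψ (q + y/2)) * ψ (q - y/2) * exp (i y·p/ε) dy`, as a complex number. -/
def wignerIntegral (d : ℕ) (ε : ℝ) (ψ : Config d → ℂ) (z : Phase d) : ℂ :=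
  (((2 * Real.pi * ε) ^ d)⁻¹ : ℝ) *
    ∫ y : Config d, (starRingEnd ℂ) (ψ (z.fst + (2⁻¹ : ℝ) • y)) * ψ (z.fst - (2⁻¹ : ℝ) • y) *
      Complex.exp (Complex.I * ((inner ℝ y z.snd / ε : ℝ) : ℂ))

/-- The Wigner integral is real: it is its own conjugate. -/
theorem conj_wignerIntegral (d : ℕ) (ε : ℝ) (ψ : Config d → ℂ) (z : Phase d) :
    (starRingEnd ℂ) (wignerIntegral d ε ψ z) = wignerIntegral d ε ψ z := by
  unfold wignerIntegral
  rw [map_mul, Complex.conj_ofReal, ← integral_conj]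
  congr 1
  rw [← integral_neg_eq_self]
  refine integral_congr_ae (Filter.Eventually.of_forall fun y => ?_)
  simp only [map_mul, Complex.conj_conj, ← Complex.exp_conj, Complex.conj_I, Complex.conj_ofReal,
    smul_neg, sub_neg_eq_add, inner_neg_left, neg_div, Complex.ofReal_neg, mul_neg, neg_mul,
    neg_neg, ← sub_eq_add_neg, map_neg]
  ring

/-- The `ε`-scaled Wigner function `W_ψ : ℝ^{2d} → ℝ`. -/
def wigner (d : ℕ) (ε : ℝ) (ψ : Config d → ℂ) (z : Phase d) : ℝ :=
  (wignerIntegral d ε ψ z).re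

theorem ofReal_wigner (d : ℕ) (ε : ℝ) (ψ : Config d → ℂ) (z : Phase d) :
    (wigner d ε ψ z : ℂ) = wignerIntegral d ε ψ z :=
  Complex.conj_eq_iff_re.mp (conj_wignerIntegral d ε ψ z)

/-- The Gaussian `g₀(x) = (πε)^{-d/4} exp (-|x|²/(2ε))` centered at the origin. -/
def gaussianZero (d : ℕ) (ε : ℝ) (x : Config d) : ℂ :=
  (((Real.pi * ε) ^ (-(d : ℝ) / 4) * Real.exp (-(‖x‖ ^ 2 / (2 * ε))) : ℝ) : ℂ)

/-- The Husimi function `H_ψ = W_ψ * W_{g₀}` (convolution on `ℝ^{2d}`). -/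
def husimi (d : ℕ) (ε : ℝ) (ψ : Config d → ℂ) (z : Phase d) : ℝ :=
  ∫ w : Phase d, wigner d ε ψ w * wigner d ε (gaussianZero d ε) (z - w)

/-- The phase space density `μ_ψ = H_ψ - (ε/4) Δ H_ψ`. -/
def muDensity (d : ℕ) (ε : ℝ) (ψ : Config d → ℂ) (z : Phase d) : ℝ :=
  husimi d ε ψ z - ε / 4 * Laplacian.laplacian (husimi d ε ψ) z

/-- The `ε`-scaled Weyl quantization of the symbol `a`, applied to `ψ`:
`(op(a)ψ)(q) = (2πε)^{-d} ∫ a((q+y)/2, p) ψ(y) exp (i (q-y)·p/ε) dy dp`. -/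
def weylOp (d : ℕ) (ε : ℝ) (a : Phase d → ℝ) (ψ : Config d → ℂ) (q : Config d) : ℂ :=
  (((2 * Real.pi * ε) ^ d)⁻¹ : ℝ) *
    ∫ yp : Config d × Config d,
      ((a (WithLp.toLp 2 ((2⁻¹ : ℝ) • (q + yp.1), yp.2)) : ℝ) : ℂ) * ψ yp.1 *
        Complex.exp (Complex.I * ((inner ℝ (q - yp.1) yp.2 / ε : ℝ) : ℂ))

end PhaseSpace

end

/-! Both quantities become integrals of `𝓕 a` against the ambiguity function `A` of `ψ`. Formally,
Weyl quantization is pairing with the Wigner function and `A` is its Fourier transform, so `⟨ψ,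
op(a)ψ⟩ = ∫ 𝓕 a · A` (`integral_conj_mul_weylOp`, `weylPairing_eq`). Convolution with the Gaussian
Wigner function multiplies `A` by `exp (-x)`, where `x = π² ε |ζ|²`, and `1 - (ε/4) Δ` multiplies it
by `1 + x` (`ofReal_husimi`, `ofReal_muDensity`).

The error is therefore `∫ 𝓕 a · A · (1 - (1 + x) exp (-x))`. The correction by `1 + x` cancels the
first-order term of the exponential, so the last factor is at most `x² = π⁴ ε² |ζ|⁴`
(`abs_one_sub_le`). With `|A| ≤ ‖ψ‖²` this yields the constant `C = π⁴ ∫ |ζ|⁴ |𝓕 a|`, in which the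
weight `|ζ|⁴` lets only derivatives of order at least four enter.

For `ψ` merely in `L²` the Wigner function need not be integrable. It is never transformed itself:
each identity is proved by Fubini after pairing with a function that decays together with its
Fourier transform. -/

noncomputable section

namespace PhaseSpace

open FourierTransform
open scoped ENNReal

variable {d : ℕ}

/-! ### Integrable weights and tame functions on phase space -/

/-- An integrable weight on configuration space with values in `(0, 1]`. -/
def weight (x : Config d) : ℝ := (1 + ‖x‖) ^ (-((d : ℝ) + 1))

theorem weight_pos (x : Config d) : 0 < weight x := by
  unfold weight; positivity

theorem weight_le_one (x : Config d) : weight x ≤ 1 :=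
  Real.rpow_le_one_of_one_le_of_nonpos (by linarith [norm_nonneg x])
    (by linarith [d.cast_nonneg (α := ℝ)])

theorem continuous_weight : Continuous (weight : Config d → ℝ) := by
  unfold weight
  exact Continuous.rpow_const (by fun_prop) fun x => Or.inl (by positivity)

@[fun_prop]
theorem measurable_weight : Measurable (weight : Config d → ℝ) := continuous_weight.measurable

theorem weight_eq_inv (x : Config d) : weight x = ((1 + ‖x‖) ^ (d + 1))⁻¹ := by
  unfold weight
  rw [Real.rpow_neg (by positivity), ← Real.rpow_natCast]
  norm_cast

theorem integrable_weight : Integrable (weight : Config d → ℝ) :=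
  integrable_one_add_norm (by simp)

theorem norm_fst_le (x p : Config d) : ‖x‖ ≤ ‖(WithLp.toLp 2 (x, p) : Phase d)‖ :=
  WithLp.norm_fst_le _ (WithLp.toLp 2 (x, p) : Phase d)

theorem norm_snd_le (x p : Config d) : ‖p‖ ≤ ‖(WithLp.toLp 2 (x, p) : Phase d)‖ :=
  WithLp.norm_snd_le _ (WithLp.toLp 2 (x, p) : Phase d)

/-- A function decaying like `(1 + ‖z‖) ^ (-2 (d + 1))` is bounded by a product of weights. -/
theorem le_mul_weight_mul_weight {r C : ℝ} {x p : Config d} (hr : 0 ≤ r)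
    (h : (1 + ‖(WithLp.toLp 2 (x, p) : Phase d)‖) ^ (2 * (d + 1)) * r ≤ C) :
    r ≤ C * (weight x * weight p) := by
  rw [weight_eq_inv, weight_eq_inv, ← mul_inv, ← div_eq_mul_inv, le_div_iff₀ (by positivity)]
  refine le_trans ?_ h
  rw [mul_comm r, ← mul_pow, pow_mul, sq]
  have := norm_fst_le x p
  have := norm_snd_le x p
  gcongr

/-- Continuous functions on phase space that decay, together with their Fourier transforms,
like a product of weights. -/
structure IsTame (b : Phase d → ℂ) : Prop where
  continuous : Continuous b
  decay : ∃ C, ∀ x p, ‖b (WithLp.toLp 2 (x, p))‖ ≤ C * (weight x * weight p)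
  fourier_decay : ∃ C, ∀ x p, ‖𝓕 b (WithLp.toLp 2 (x, p))‖ ≤ C * (weight x * weight p)

theorem exists_schwartz_decay (b : 𝓢(Phase d, ℂ)) :
    ∃ C, ∀ x p, ‖b (WithLp.toLp 2 (x, p))‖ ≤ C * (weight x * weight p) := by
  refine ⟨2 ^ (2 * (d + 1)) * (Finset.Iic (2 * (d + 1), 0)).sup
    (fun m => SchwartzMap.seminorm ℝ m.1 m.2) b,
    fun x p => le_mul_weight_mul_weight (norm_nonneg _) ?_⟩
  simpa using SchwartzMap.one_add_le_sup_seminorm_apply (𝕜 := ℝ) (m := (2 * (d + 1), 0)) le_rfl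
    le_rfl b (WithLp.toLp 2 (x, p))

/-- Tameness is what the pairing identities need. It covers Schwartz symbols here and translated
Gaussians in `isTame_gaussianWigner`, so each identity is proved once and used for both the Weyl
form and the Husimi function. -/
theorem isTame_schwartz (b : 𝓢(Phase d, ℂ)) : IsTame (b : Phase d → ℂ) :=
  ⟨b.continuous, exists_schwartz_decay b, exists_schwartz_decay (𝓕 b)⟩

section PhaseIntegral

variable {F : Type*} [NormedAddCommGroup F]

theorem measurableEmbedding_toLp :
    MeasurableEmbedding (WithLp.toLp 2 : Config d × Config d → Phase d) :=
  (MeasurableEquiv.toLp 2 (Config d × Config d)).measurableEmbedding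

theorem integrable_phase_iff {f : Phase d → F} :
    Integrable f ↔ Integrable (fun z : Config d × Config d => f (WithLp.toLp 2 z)) :=
  ((WithLp.volume_preserving_toLp _ _).integrable_comp_emb measurableEmbedding_toLp).symm

theorem integral_phase [NormedSpace ℝ F] (f : Phase d → F) :
    ∫ z, f z = ∫ z : Config d × Config d, f (WithLp.toLp 2 z) :=
  ((WithLp.volume_preserving_toLp _ _).integral_comp measurableEmbedding_toLp f).symm

theorem integral_phase_iterated [NormedSpace ℝ F] {f : Phase d → F} (hf : Integrable f) :
    ∫ z, f z = ∫ x, ∫ p, f (WithLp.toLp 2 (x, p)) := by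
  rw [integral_phase]
  exact integral_prod _ (integrable_phase_iff.1 hf)

end PhaseIntegral

theorem integrable_of_decay {b : Phase d → ℂ} (hm : AEStronglyMeasurable b)
    (h : ∃ C, ∀ x p, ‖b (WithLp.toLp 2 (x, p))‖ ≤ C * (weight x * weight p)) : Integrable b := by
  obtain ⟨C, hC⟩ := h
  refine integrable_phase_iff.2 <|
    Integrable.mono' ((integrable_weight.mul_prod integrable_weight).const_mul C) ?_
    (Filter.Eventually.of_forall fun z => hC z.1 z.2)
  exact hm.comp_measurePreserving (WithLp.volume_preserving_toLp _ _)

namespace IsTame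

variable {b : Phase d → ℂ}

theorem integrable (hb : IsTame b) : Integrable b :=
  integrable_of_decay hb.continuous.aestronglyMeasurable hb.decay

theorem continuous_fourier (hb : IsTame b) : Continuous (𝓕 b) :=
  VectorFourier.fourierIntegral_continuous Real.continuous_fourierChar continuous_inner
    hb.integrable

theorem integrable_fourier (hb : IsTame b) : Integrable (𝓕 b) :=
  integrable_of_decay hb.continuous_fourier.aestronglyMeasurable hb.fourier_decay

theorem integrable_section (hb : IsTame b) (x : Config d) :
    Integrable fun p => b (WithLp.toLp 2 (x, p)) := by
  obtain ⟨C, hC⟩ := hb.decay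
  have := hb.continuous
  refine Integrable.mono' ((integrable_weight.const_mul (weight x)).const_mul C) ?_
    (Filter.Eventually.of_forall (hC x))
  exact Continuous.aestronglyMeasurable (by fun_prop)

theorem integrable_fourier_section (hb : IsTame b) (p : Config d) :
    Integrable fun x => 𝓕 b (WithLp.toLp 2 (x, p)) := by
  obtain ⟨C, hC⟩ := hb.fourier_decay
  have := hb.continuous_fourier
  refine Integrable.mono' ((integrable_weight.mul_const (weight p)).const_mul C) ?_
    (Filter.Eventually.of_forall fun x => hC x p)
  exact Continuous.aestronglyMeasurable (by fun_prop)

end IsTame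

/-! ### Partial Fourier transform in momentum -/

/-- The `ε`-scaled Fourier transform of `b` in the momentum variable. -/
def fiberFourier (ε : ℝ) (b : Phase d → ℂ) (x v : Config d) : ℂ :=
  ∫ p : Config d, b (WithLp.toLp 2 (x, p)) *
    Complex.exp (Complex.I * ((inner ℝ v p / ε : ℝ) : ℂ))

theorem norm_cexp_I_mul_ofReal (t : ℝ) : ‖Complex.exp (Complex.I * (t : ℂ))‖ = 1 := by
  rw [mul_comm, Complex.norm_exp_ofReal_mul_I]

theorem continuous_fiberFourier {ε : ℝ} {b : Phase d → ℂ} (hb : IsTame b) :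
    Continuous fun z : Config d × Config d => fiberFourier ε b z.1 z.2 := by
  obtain ⟨C, hC⟩ := hb.decay
  have := hb.continuous
  have hC0 (x p : Config d) : 0 ≤ C := by
    have h1 := (norm_nonneg _).trans (hC x p)
    have h2 := mul_pos (weight_pos x) (weight_pos p)
    exact nonneg_of_mul_nonneg_left h1 h2
  refine continuous_of_dominated (bound := fun p => C * weight p) ?_ ?_
    (integrable_weight.const_mul C) ?_
  · exact fun z => Continuous.aestronglyMeasurable (by fun_prop)
  · refine fun z => Filter.Eventually.of_forall fun p => ?_
    rw [norm_mul, norm_cexp_I_mul_ofReal, mul_one]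
    refine (hC _ _).trans ?_
    have := weight_le_one z.1
    have := weight_pos p
    have := hC0 z.1 p
    gcongr
    nlinarith
  · exact Filter.Eventually.of_forall fun p => by fun_prop

/-- Fourier inversion in the position variable. -/
theorem fiberFourier_eq {ε : ℝ} (hε : 0 < ε) {b : Phase d → ℂ} (hb : IsTame b) (x v : Config d) :
    fiberFourier ε b x v = ∫ ξ : Config d,
      𝓕 b (WithLp.toLp 2 (ξ, -(2 * Real.pi * ε)⁻¹ • v)) *
        Complex.exp (Complex.I * ((2 * Real.pi * inner ℝ x ξ : ℝ) : ℂ)) := by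
  -- Since `exp (i v·p/ε) = exp (-2πi p·η)` for `η = -v/(2πε)`, transforming the remaining variable
  -- `x` completes the full Fourier transform at `(ξ, η)`.
  have hF : 𝓕 (fun x => fiberFourier ε b x v) =
      fun ξ => 𝓕 b (WithLp.toLp 2 (ξ, -(2 * Real.pi * ε)⁻¹ • v)) := by
    ext ξ
    rw [Real.fourier_eq', Real.fourier_eq', integral_phase_iterated]
    · congr 1; ext y
      rw [fiberFourier, smul_eq_mul, ← integral_const_mul]
      congr 1; ext p
      simp only [WithLp.prod_inner_apply, smul_eq_mul]
      rw [mul_left_comm, mul_comm _ (b _), mul_assoc, ← Complex.exp_add]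
      congr 2
      rw [inner_smul_right, real_inner_comm p v]
      push_cast
      have : (Real.pi : ℂ) ≠ 0 := by exact_mod_cast Real.pi_ne_zero
      have : (ε : ℂ) ≠ 0 := by exact_mod_cast hε.ne'
      field_simp
      ring
    · refine hb.integrable.bdd_mul (c := 1) (Continuous.aestronglyMeasurable (by fun_prop)) ?_
      refine Filter.Eventually.of_forall fun z => ?_
      rw [Complex.norm_exp_ofReal_mul_I]
  have hc : Continuous fun x => fiberFourier ε b x v :=
    (continuous_fiberFourier hb).comp (by fun_prop : Continuous fun x => (x, v))
  obtain ⟨C, hC⟩ := hb.decay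
  have hi : Integrable fun x => fiberFourier ε b x v := by
    refine Integrable.mono' (integrable_weight.mul_const (∫ p : Config d, C * weight p))
      hc.aestronglyMeasurable
      (Filter.Eventually.of_forall fun y => ?_)
    rw [← integral_const_mul]
    refine norm_integral_le_of_norm_le ((integrable_weight.const_mul C).const_mul _)
      (Filter.Eventually.of_forall fun p => ?_)
    rw [norm_mul, norm_cexp_I_mul_ofReal, mul_one]
    exact (hC _ _).trans_eq (by ring)
  have := congrFun (hc.fourierInv_fourier_eq hi
    (by rw [hF]; exact hb.integrable_fourier_section _)) x
  rw [← this, hF, Real.fourierInv_eq']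
  congr 1; ext ξ
  rw [smul_eq_mul, mul_comm, real_inner_comm, mul_comm (Complex.I)]

/-- Decay of `𝓕 b` in the momentum frequency becomes decay in `v`, uniform in `x`. This supplies the
integrability in `v` that correlations of `L²` functions lack on the product space. -/
theorem norm_fiberFourier_le {ε : ℝ} (hε : 0 < ε) {b : Phase d → ℂ} (hb : IsTame b) :
    ∃ C, ∀ x v, ‖fiberFourier ε b x v‖ ≤ C * weight ((2 * Real.pi * ε)⁻¹ • v) := by
  obtain ⟨C, hC⟩ := hb.fourier_decay
  refine ⟨∫ ξ : Config d, C * weight ξ, fun x v => ?_⟩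
  rw [fiberFourier_eq hε hb, ← integral_mul_const]
  refine norm_integral_le_of_norm_le ((integrable_weight.const_mul C).mul_const _)
    (Filter.Eventually.of_forall fun ξ => ?_)
  rw [norm_mul, norm_cexp_I_mul_ofReal, mul_one]
  refine (hC _ _).trans_eq ?_
  simp only [weight, neg_smul, norm_neg]
  ring

/-! ### Correlations of an `L²` function -/

/-- The correlation `conj (ψ (x + v/2)) * ψ (x - v/2)`. -/
def correlation (ψ : Config d → ℂ) (x v : Config d) : ℂ :=
  (starRingEnd ℂ) (ψ (x + (2⁻¹ : ℝ) • v)) * ψ (x - (2⁻¹ : ℝ) • v)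

theorem measurePreserving_shear (c : ℝ) :
    MeasurePreserving fun z : Config d × Config d => (z.1 + c • z.2, z.2) := by
  have h : MeasurePreserving fun z : Config d × Config d => (z.1, z.2 + c • z.1) :=
    (MeasurePreserving.id volume).skew_product (g := fun v x => x + c • v) (by fun_prop)
      (Filter.Eventually.of_forall fun v => map_add_right_eq_self volume (c • v))
  exact (Measure.measurePreserving_swap.comp h).comp Measure.measurePreserving_swap

/-- The change of variables from midpoint and difference to the two endpoints. -/
theorem measurePreserving_endpoints :
    MeasurePreserving fun z : Config d × Config d =>
      (z.1 + (2⁻¹ : ℝ) • z.2, z.1 - (2⁻¹ : ℝ) • z.2) := by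
  have h : MeasurePreserving fun z : Config d × Config d => (z.1, z.1 - z.2) :=
    (MeasurePreserving.id volume).skew_product (g := fun x v => x - v) (by fun_prop)
      (Filter.Eventually.of_forall fun x => (Measure.measurePreserving_sub_left volume x).map_eq)
  -- The shear sends `(x, v)` to `(x + v/2, v)`, and subtracting the second entry from the first
  -- leaves `x - v/2`.
  convert! h.comp (measurePreserving_shear 2⁻¹) using 2 with z
  simp only [Function.comp]
  congr 1
  module

/-- The arithmetic-geometric mean inequality replaces Cauchy–Schwarz: the bound consists of
translates of `|ψ|²`, each with the same integral in `x`, so nothing is lost after integrating. -/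
theorem norm_correlation_le (ψ : Config d → ℂ) (x v : Config d) :
    ‖correlation ψ x v‖ ≤
      2⁻¹ * (‖ψ (x + (2⁻¹ : ℝ) • v)‖ ^ 2 + ‖ψ (x - (2⁻¹ : ℝ) • v)‖ ^ 2) := by
  rw [correlation, norm_mul, RCLike.norm_conj]
  nlinarith [sq_nonneg (‖ψ (x + (2⁻¹ : ℝ) • v)‖ - ‖ψ (x - (2⁻¹ : ℝ) • v)‖)]

theorem measurable_correlation {ψ : Config d → ℂ} (hm : Measurable ψ) :
    Measurable fun z : Config d × Config d => correlation ψ z.1 z.2 := by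
  unfold correlation
  have : Measurable (starRingEnd ℂ) := Complex.continuous_conj.measurable
  fun_prop

theorem integrable_correlation_left {ψ : Config d → ℂ} (hm : Measurable ψ)
    (hψ : Integrable fun x => ‖ψ x‖ ^ 2) (v : Config d) :
    Integrable fun x => correlation ψ x v := by
  refine Integrable.mono' (((hψ.comp_add_right ((2⁻¹ : ℝ) • v)).add
    (hψ.comp_sub_right ((2⁻¹ : ℝ) • v))).const_mul 2⁻¹) ?_
    (Filter.Eventually.of_forall fun x => norm_correlation_le ψ x v)
  exact ((measurable_correlation hm).comp measurable_prodMk_right).aestronglyMeasurable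

theorem integral_norm_correlation_left_le {ψ : Config d → ℂ}
    (hψ : Integrable fun x => ‖ψ x‖ ^ 2) (v : Config d) :
    ∫ x, ‖correlation ψ x v‖ ≤ ∫ x, ‖ψ x‖ ^ 2 := by
  have h1 := hψ.comp_add_right ((2⁻¹ : ℝ) • v)
  have h2 := hψ.comp_sub_right ((2⁻¹ : ℝ) • v)
  refine (integral_mono_of_nonneg (Filter.Eventually.of_forall fun x => norm_nonneg _)
    ((h1.add h2).const_mul 2⁻¹)
    (Filter.Eventually.of_forall fun x => norm_correlation_le ψ x v)).trans_eq ?_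
  simp only [Pi.add_apply]
  rw [integral_const_mul, integral_add h1 h2, integral_add_right_eq_self (fun x => ‖ψ x‖ ^ 2),
    integral_sub_right_eq_self (fun x => ‖ψ x‖ ^ 2)]
  ring

theorem integrable_norm_sq_affine {ψ : Config d → ℂ} (hψ : Integrable fun x => ‖ψ x‖ ^ 2)
    {c : ℝ} (hc : c ≠ 0) (x : Config d) : Integrable fun v => ‖ψ (x + c • v)‖ ^ 2 :=
  (hψ.comp_add_left x).comp_smul hc

theorem integral_norm_sq_affine (ψ : Config d → ℂ) (c : ℝ) (x : Config d) :
    ∫ v, ‖ψ (x + c • v)‖ ^ 2 = |(c ^ d)⁻¹| * ∫ v, ‖ψ v‖ ^ 2 := by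
  rw [Measure.integral_comp_smul volume (fun y => ‖ψ (x + y)‖ ^ 2),
    integral_add_left_eq_self (fun y => ‖ψ y‖ ^ 2)]
  simp

theorem norm_correlation_le' (ψ : Config d → ℂ) (x v : Config d) :
    ‖correlation ψ x v‖ ≤
      2⁻¹ * (‖ψ (x + (2⁻¹ : ℝ) • v)‖ ^ 2 + ‖ψ (x + (-2⁻¹ : ℝ) • v)‖ ^ 2) := by
  simpa [sub_eq_add_neg] using norm_correlation_le ψ x v

theorem integrable_correlation_right {ψ : Config d → ℂ} (hm : Measurable ψ)
    (hψ : Integrable fun x => ‖ψ x‖ ^ 2) (x : Config d) :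
    Integrable fun v => correlation ψ x v := by
  refine Integrable.mono' (((integrable_norm_sq_affine hψ (by norm_num) x).add
    (integrable_norm_sq_affine hψ (by norm_num) x)).const_mul 2⁻¹) ?_
    (Filter.Eventually.of_forall fun v => norm_correlation_le' ψ x v)
  exact ((measurable_correlation hm).comp measurable_prodMk_left).aestronglyMeasurable

/-- The factor `2 ^ d` is the Jacobian of the dilation `v ↦ v/2`. -/
theorem integral_norm_correlation_right_le {ψ : Config d → ℂ}
    (hψ : Integrable fun x => ‖ψ x‖ ^ 2) (x : Config d) :
    ∫ v, ‖correlation ψ x v‖ ≤ 2 ^ d * ∫ x, ‖ψ x‖ ^ 2 := by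
  have h1 : Integrable fun v => ‖ψ (x + (2⁻¹ : ℝ) • v)‖ ^ 2 :=
    integrable_norm_sq_affine hψ (by norm_num) x
  have h2 : Integrable fun v => ‖ψ (x + (-2⁻¹ : ℝ) • v)‖ ^ 2 :=
    integrable_norm_sq_affine hψ (by norm_num) x
  refine (integral_mono_of_nonneg (Filter.Eventually.of_forall fun x => norm_nonneg _)
    ((h1.add h2).const_mul 2⁻¹)
    (Filter.Eventually.of_forall fun v => norm_correlation_le' ψ x v)).trans_eq ?_
  simp only [Pi.add_apply]
  rw [integral_const_mul, integral_add h1 h2, integral_norm_sq_affine, integral_norm_sq_affine]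
  simp only [inv_pow, inv_inv, abs_inv, abs_pow, abs_neg]
  norm_num
  ring

/-- A shear carries `|ψ (x ± v/2)|² k(v)` to the product `|ψ x|² k(v)`, which is integrable. -/
theorem integrable_correlation_mul {ψ : Config d → ℂ} (hm : Measurable ψ)
    (hψ : Integrable fun x => ‖ψ x‖ ^ 2) {g : Config d → Config d → ℂ} {k : Config d → ℝ}
    (hg : Measurable fun z : Config d × Config d => g z.1 z.2) (hk : Integrable k)
    (hgk : ∀ x v, ‖g x v‖ ≤ k v) :
    Integrable fun z : Config d × Config d => correlation ψ z.1 z.2 * g z.1 z.2 := by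
  have h0 : Integrable fun z : Config d × Config d => ‖ψ z.1‖ ^ 2 * k z.2 := hψ.mul_prod hk
  have h1 (c : ℝ) : Integrable fun z : Config d × Config d => ‖ψ (z.1 + c • z.2)‖ ^ 2 * k z.2 :=
    ((measurePreserving_shear c).integrable_comp h0.aestronglyMeasurable).2 h0
  refine Integrable.mono' (((h1 2⁻¹).add (h1 (-2⁻¹))).const_mul 2⁻¹)
    ((measurable_correlation hm).mul hg).aestronglyMeasurable
    (Filter.Eventually.of_forall fun z => ?_)
  rw [norm_mul]
  refine (mul_le_mul (norm_correlation_le' ψ z.1 z.2) (hgk _ _) (norm_nonneg _)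
    (by positivity)).trans_eq ?_
  simp only [Pi.add_apply]
  ring

theorem integrable_scaled_weight {c : ℝ} (hc : c ≠ 0) :
    Integrable fun v : Config d => weight (c • v) :=
  integrable_weight.comp_smul hc

theorem integrable_correlation_mul_fiberFourier {ε : ℝ} (hε : 0 < ε) {ψ : Config d → ℂ}
    (hm : Measurable ψ) (hψ : Integrable fun x => ‖ψ x‖ ^ 2) {b : Phase d → ℂ} (hb : IsTame b) :
    Integrable fun z : Config d × Config d =>
      correlation ψ z.1 z.2 * fiberFourier ε b z.1 z.2 := by
  obtain ⟨C, hC⟩ := norm_fiberFourier_le hε hb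
  exact integrable_correlation_mul hm hψ (continuous_fiberFourier hb).measurable
    ((integrable_scaled_weight (by positivity)).const_mul C) hC

/-! ### Wigner pairing and ambiguity function -/

/-- The pairing of the Wigner function of `ψ` with `b`, with the momentum integral done first. -/
def weylPairing (ε : ℝ) (ψ : Config d → ℂ) (b : Phase d → ℂ) : ℂ :=
  (((2 * Real.pi * ε) ^ d)⁻¹ : ℝ) *
    ∫ z : Config d × Config d, correlation ψ z.1 z.2 * fiberFourier ε b z.1 z.2

theorem wignerIntegral_eq (ε : ℝ) (ψ : Config d → ℂ) (z : Phase d) :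
    wignerIntegral d ε ψ z = (((2 * Real.pi * ε) ^ d)⁻¹ : ℝ) *
      ∫ v : Config d, correlation ψ z.fst v *
        Complex.exp (Complex.I * ((inner ℝ v z.snd / ε : ℝ) : ℂ)) := rfl

theorem measurable_phase_fst : Measurable fun z : Phase d => z.fst :=
  Continuous.measurable (by fun_prop)

theorem measurable_phase_snd : Measurable fun z : Phase d => z.snd :=
  Continuous.measurable (by fun_prop)

theorem measurable_wignerIntegral {ε : ℝ} {ψ : Config d → ℂ} (hm : Measurable ψ) :
    Measurable (wignerIntegral d ε ψ) := by
  have h1 : Measurable fun zv : Phase d × Config d => zv.1.fst :=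
    measurable_phase_fst.comp measurable_fst
  have h2 : Measurable fun zv : Phase d × Config d => zv.1.snd :=
    measurable_phase_snd.comp measurable_fst
  have h : Measurable fun zv : Phase d × Config d => correlation ψ zv.1.fst zv.2 *
      Complex.exp (Complex.I * ((inner ℝ zv.2 zv.1.snd / ε : ℝ) : ℂ)) :=
    ((measurable_correlation hm).comp (h1.prodMk measurable_snd)).mul
      (((measurable_snd.inner h2).div_const ε).complex_ofReal.const_mul _).cexp
  exact h.stronglyMeasurable.integral_prod_right'.measurable.const_mul _

/-- Boundedness replaces integrability of the Wigner function: it suffices for pairing with an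
integrable `b`. -/
theorem norm_wignerIntegral_le {ε : ℝ} (hε : 0 < ε) {ψ : Config d → ℂ}
    (hψ : Integrable fun x => ‖ψ x‖ ^ 2) (z : Phase d) :
    ‖wignerIntegral d ε ψ z‖ ≤ ((2 * Real.pi * ε) ^ d)⁻¹ * (2 ^ d * ∫ x, ‖ψ x‖ ^ 2) := by
  rw [wignerIntegral_eq, norm_mul, Complex.norm_real, Real.norm_of_nonneg (by positivity)]
  gcongr
  refine (norm_integral_le_integral_norm _).trans ?_
  simpa only [norm_mul, norm_cexp_I_mul_ofReal, mul_one]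
    using integral_norm_correlation_right_le hψ z.fst

theorem integral_wignerIntegral_mul {ε : ℝ} (hε : 0 < ε) {ψ : Config d → ℂ}
    (hm : Measurable ψ) (hψ : Integrable fun x => ‖ψ x‖ ^ 2) {b : Phase d → ℂ} (hb : IsTame b) :
    ∫ z, wignerIntegral d ε ψ z * b z = weylPairing ε ψ b := by
  rw [integral_phase_iterated (hb.integrable.bdd_mul
    (measurable_wignerIntegral hm).aestronglyMeasurable
    (Filter.Eventually.of_forall (norm_wignerIntegral_le hε hψ)))]
  rw [weylPairing, Measure.volume_eq_prod,
    integral_prod _ (integrable_correlation_mul_fiberFourier hε hm hψ hb), ← integral_const_mul]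
  congr 1; ext x
  simp only [wignerIntegral_eq, mul_assoc]
  rw [integral_const_mul]
  congr 1
  simp only [← integral_mul_const, fiberFourier, ← integral_const_mul]
  rw [integral_integral_swap]
  · congr 1; ext v; congr 1; ext p
    rw [WithLp.toLp_fst, WithLp.toLp_snd]
    ring
  · have h := (hb.integrable_section x).mul_prod (integrable_correlation_right hm hψ x)
    refine (h.bdd_mul (c := 1) (f := fun z : Config d × Config d =>
      Complex.exp (Complex.I * ((inner ℝ z.2 z.1 / ε : ℝ) : ℂ)))
      (Continuous.aestronglyMeasurable (by fun_prop))
      (Filter.Eventually.of_forall fun z => ?_)).congr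
      (Filter.Eventually.of_forall fun z => ?_)
    · exact (norm_cexp_I_mul_ofReal _).le
    · simp only [Function.uncurry, WithLp.toLp_fst, WithLp.toLp_snd]
      ring

/-- The ambiguity function of `ψ`, the Fourier transform of its Wigner function. -/
def ambiguity (ε : ℝ) (ψ : Config d → ℂ) (ζ : Phase d) : ℂ :=
  ∫ x : Config d, correlation ψ x (-(2 * Real.pi * ε) • ζ.snd) *
    Complex.exp (Complex.I * ((2 * Real.pi * inner ℝ x ζ.fst : ℝ) : ℂ))

theorem measurable_ambiguity {ε : ℝ} {ψ : Config d → ℂ} (hm : Measurable ψ) :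
    Measurable (ambiguity ε ψ) := by
  have h1 : Measurable fun zx : Phase d × Config d => zx.1.fst :=
    measurable_phase_fst.comp measurable_fst
  have h2 : Measurable fun zx : Phase d × Config d => zx.1.snd :=
    measurable_phase_snd.comp measurable_fst
  have h3 : Measurable fun zx : Phase d × Config d =>
      correlation ψ zx.2 (-(2 * Real.pi * ε) • zx.1.snd) :=
    (measurable_correlation hm).comp (measurable_snd.prodMk (h2.const_smul (-(2 * Real.pi * ε))))
  have h4 : Measurable fun zx : Phase d × Config d =>
      (2 * Real.pi * inner ℝ zx.2 zx.1.fst : ℝ) := (measurable_snd.inner h1).const_mul _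
  have h5 : Measurable fun zx : Phase d × Config d =>
      Complex.exp (Complex.I * ((2 * Real.pi * inner ℝ zx.2 zx.1.fst : ℝ) : ℂ)) :=
    (h4.complex_ofReal.const_mul _).cexp
  exact (h3.mul h5).stronglyMeasurable.integral_prod_right'.measurable

theorem norm_ambiguity_le {ε : ℝ} {ψ : Config d → ℂ}
    (hψ : Integrable fun x => ‖ψ x‖ ^ 2) (ζ : Phase d) :
    ‖ambiguity ε ψ ζ‖ ≤ ∫ x, ‖ψ x‖ ^ 2 := by
  refine (norm_integral_le_integral_norm _).trans ?_
  simpa only [norm_mul, norm_cexp_I_mul_ofReal, mul_one]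
    using integral_norm_correlation_left_le hψ _

theorem integrable_mul_ambiguity {ε : ℝ} {ψ : Config d → ℂ} (hm : Measurable ψ)
    (hψ : Integrable fun x => ‖ψ x‖ ^ 2) {f : Phase d → ℂ} (hf : Integrable f) :
    Integrable fun ζ => f ζ * ambiguity ε ψ ζ :=
  hf.mul_bdd (measurable_ambiguity hm).aestronglyMeasurable
    (Filter.Eventually.of_forall (norm_ambiguity_le hψ))

/-- A Parseval identity: insert the inversion formula `fiberFourier_eq` and exchange the integrals
over position and frequency at fixed `v`. -/
theorem weylPairing_eq {ε : ℝ} (hε : 0 < ε) {ψ : Config d → ℂ}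
    (hm : Measurable ψ) (hψ : Integrable fun x => ‖ψ x‖ ^ 2) {b : Phase d → ℂ} (hb : IsTame b) :
    weylPairing ε ψ b = ∫ ζ, 𝓕 b ζ * ambiguity ε ψ ζ := by
  have hi := integrable_mul_ambiguity (ε := ε) hm hψ hb.integrable_fourier
  rw [integral_phase, Measure.volume_eq_prod, integral_prod_symm _ (integrable_phase_iff.1 hi),
    weylPairing, Measure.volume_eq_prod,
    integral_prod_symm _ (integrable_correlation_mul_fiberFourier hε hm hψ hb)]
  -- The substitution `v = -2πε η` turns the momentum frequency into `η`; its Jacobian is exactly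
  -- the prefactor of `weylPairing`.
  have hs := Measure.integral_comp_smul volume
    (fun v : Config d => ∫ x, correlation ψ x v * fiberFourier ε b x v) (-(2 * Real.pi * ε))
  rw [finrank_euclideanSpace, Fintype.card_fin, abs_inv, abs_pow, abs_neg,
    abs_of_pos (by positivity), Complex.real_smul] at hs
  rw [← hs]
  congr 1; ext η
  simp only [fiberFourier_eq hε hb, ambiguity, ← integral_const_mul, smul_smul]
  have h1 : -(2 * Real.pi * ε)⁻¹ * -(2 * Real.pi * ε) = 1 := by
    have := Real.pi_pos
    field_simp
  simp only [h1, one_smul]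
  rw [integral_integral_swap]
  · congr 1; ext ξ; congr 1; ext x
    rw [WithLp.toLp_fst, WithLp.toLp_snd]
    ring
  · have h := (integrable_correlation_left hm hψ (-(2 * Real.pi * ε) • η)).mul_prod
      (hb.integrable_fourier_section η)
    refine (h.bdd_mul (c := 1) (f := fun z : Config d × Config d =>
      Complex.exp (Complex.I * ((2 * Real.pi * inner ℝ z.1 z.2 : ℝ) : ℂ)))
      (Continuous.aestronglyMeasurable (by fun_prop))
      (Filter.Eventually.of_forall fun z => ?_)).congr
      (Filter.Eventually.of_forall fun z => ?_)
    · exact (norm_cexp_I_mul_ofReal _).le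
    · simp only [Function.uncurry]
      ring

/-! ### The Weyl operator: quadratic form and `L²` bound -/

theorem weylOp_eq {ε : ℝ} {a : Phase d → ℝ} (ha : IsTame fun z => (a z : ℂ)) {ψ : Config d → ℂ}
    (hm : Measurable ψ) (hψ : Integrable fun x => ‖ψ x‖ ^ 2) (q : Config d) :
    weylOp d ε a ψ q = (((2 * Real.pi * ε) ^ d)⁻¹ : ℝ) *
      ∫ y, ψ y * fiberFourier ε (fun z => (a z : ℂ)) ((2⁻¹ : ℝ) • (q + y)) (q - y) := by
  obtain ⟨C, hC⟩ := ha.decay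
  have hw : Integrable fun y => weight ((2⁻¹ : ℝ) • (q + y)) :=
    (integrable_scaled_weight (c := 2⁻¹) (by norm_num)).comp_add_left q
  -- Since `0 < w ≤ 1`, one has `w|ψ| ≤ (w² + |ψ|²)/2 ≤ w + |ψ|²`.
  have hi : Integrable fun y => weight ((2⁻¹ : ℝ) • (q + y)) * ‖ψ y‖ := by
    refine Integrable.mono' (hw.add hψ) (Measurable.aestronglyMeasurable (by fun_prop))
      (Filter.Eventually.of_forall fun y => ?_)
    have h0 := weight_pos ((2⁻¹ : ℝ) • (q + y))
    have h1 := weight_le_one ((2⁻¹ : ℝ) • (q + y))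
    rw [Real.norm_of_nonneg (by positivity), Pi.add_apply]
    nlinarith [sq_nonneg (weight ((2⁻¹ : ℝ) • (q + y)) - ‖ψ y‖), sq_nonneg ‖ψ y‖]
  have hc := ha.continuous
  rw [weylOp, Measure.volume_eq_prod, integral_prod]
  · simp only [fiberFourier, ← integral_const_mul]
    congr 2; ext y; congr 1; ext p
    ring
  · refine Integrable.mono' ((hi.mul_prod integrable_weight).const_mul C) ?_
      (Filter.Eventually.of_forall fun z => ?_)
    · refine Measurable.aestronglyMeasurable (Measurable.mul (Measurable.mul ?_ (by fun_prop)) ?_)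
      · exact (hc.comp (by fun_prop : Continuous fun z : Config d × Config d =>
          (WithLp.toLp 2 ((2⁻¹ : ℝ) • (q + z.1), z.2) : Phase d))).measurable
      · exact Continuous.measurable (by fun_prop)
    · rw [norm_mul, norm_mul, norm_cexp_I_mul_ofReal, mul_one]
      refine (mul_le_mul_of_nonneg_right (hC _ _) (norm_nonneg _)).trans_eq ?_
      ring

theorem measurable_weylKernel {ε : ℝ} {b : Phase d → ℂ} (hb : IsTame b) {ψ : Config d → ℂ}
    (hm : Measurable ψ) : Measurable fun z : Config d × Config d =>
      ψ z.2 * fiberFourier ε b ((2⁻¹ : ℝ) • (z.1 + z.2)) (z.1 - z.2) := by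
  refine (hm.comp measurable_snd).mul ?_
  exact (continuous_fiberFourier hb).measurable.comp (Continuous.measurable
    (f := fun z : Config d × Config d => ((2⁻¹ : ℝ) • (z.1 + z.2), z.1 - z.2)) (by fun_prop))

/-- With endpoints `q = x + v/2` and `y = x - v/2`, the midpoint is `x` and the difference is `v`,
so the Weyl kernel becomes `fiberFourier` at `(x, v)`. -/
theorem integral_conj_mul_weylOp {ε : ℝ} (hε : 0 < ε) {a : Phase d → ℝ}
    (ha : IsTame fun z => (a z : ℂ)) {ψ : Config d → ℂ} (hm : Measurable ψ)
    (hψ : Integrable fun x => ‖ψ x‖ ^ 2) :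
    ∫ q, (starRingEnd ℂ) (ψ q) * weylOp d ε a ψ q = weylPairing ε ψ fun z => (a z : ℂ) := by
  have hconj : Measurable fun z : Config d × Config d => (starRingEnd ℂ) (ψ z.1) :=
    Complex.continuous_conj.measurable.comp (hm.comp measurable_fst)
  have hK : Measurable fun z : Config d × Config d => (starRingEnd ℂ) (ψ z.1) *
      (ψ z.2 * fiberFourier ε (fun z => (a z : ℂ)) ((2⁻¹ : ℝ) • (z.1 + z.2)) (z.1 - z.2)) :=
    hconj.mul (measurable_weylKernel ha hm)
  have he := measurePreserving_endpoints (d := d)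
  have hcomp (z : Config d × Config d) : (starRingEnd ℂ) (ψ (z.1 + (2⁻¹ : ℝ) • z.2)) *
      (ψ (z.1 - (2⁻¹ : ℝ) • z.2) * fiberFourier ε (fun z => (a z : ℂ))
        ((2⁻¹ : ℝ) • (z.1 + (2⁻¹ : ℝ) • z.2 + (z.1 - (2⁻¹ : ℝ) • z.2)))
        (z.1 + (2⁻¹ : ℝ) • z.2 - (z.1 - (2⁻¹ : ℝ) • z.2))) =
      correlation ψ z.1 z.2 * fiberFourier ε (fun z => (a z : ℂ)) z.1 z.2 := by
    have h1 : (2⁻¹ : ℝ) • (z.1 + (2⁻¹ : ℝ) • z.2 + (z.1 - (2⁻¹ : ℝ) • z.2)) = z.1 := by module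
    have h2 : z.1 + (2⁻¹ : ℝ) • z.2 - (z.1 - (2⁻¹ : ℝ) • z.2) = z.2 := by module
    rw [h1, h2, correlation, mul_assoc]
  have hi : Integrable fun z : Config d × Config d => (starRingEnd ℂ) (ψ z.1) *
      (ψ z.2 * fiberFourier ε (fun z => (a z : ℂ)) ((2⁻¹ : ℝ) • (z.1 + z.2)) (z.1 - z.2)) := by
    rw [← he.integrable_comp hK.aestronglyMeasurable]
    refine (integrable_correlation_mul_fiberFourier hε hm hψ ha).congr
      (Filter.Eventually.of_forall fun z => (hcomp z).symm)
  rw [weylPairing]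
  simp only [← hcomp]
  have := integral_map he.measurable.aemeasurable (f := fun z : Config d × Config d =>
    (starRingEnd ℂ) (ψ z.1) * (ψ z.2 * fiberFourier ε (fun z => (a z : ℂ))
      ((2⁻¹ : ℝ) • (z.1 + z.2)) (z.1 - z.2))) (by rw [he.map_eq]; exact hi.aestronglyMeasurable)
  rw [he.map_eq] at this
  rw [← this, Measure.volume_eq_prod, integral_prod _ hi, ← integral_const_mul]
  congr 1; ext q
  rw [weylOp_eq ha hm hψ, mul_left_comm, ← integral_const_mul]

/-- Young's inequality for the convolution of an `L²` function with an `L¹` kernel. -/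
theorem lintegral_convolution_sq_le {f k : Config d → ℝ≥0∞} (hf : Measurable f)
    (hk : Measurable k) :
    ∫⁻ q, (∫⁻ y, f y * k (q - y)) ^ 2 ≤ (∫⁻ y, k y) ^ 2 * ∫⁻ y, f y ^ 2 := by
  have hk' (q : Config d) : ∫⁻ y, k (q - y) = ∫⁻ y, k y := lintegral_sub_left_eq_self k q
  -- Cauchy–Schwarz with the splitting `f k = (f k^{1/2}) · k^{1/2}`.
  have key (q : Config d) :
      (∫⁻ y, f y * k (q - y)) ^ 2 ≤ (∫⁻ y, k y) * ∫⁻ y, f y ^ 2 * k (q - y) := by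
    have hs (t : ℝ≥0∞) : (t ^ (2⁻¹ : ℝ)) ^ (2 : ℝ) = t := by
      rw [← ENNReal.rpow_mul]; norm_num
    have hm : Measurable fun y => k (q - y) ^ (2⁻¹ : ℝ) := by fun_prop
    have h := ENNReal.lintegral_mul_le_Lp_mul_Lq volume Real.HolderConjugate.two_two
      (hf.mul hm).aemeasurable hm.aemeasurable
    have h2 (y : Config d) : f y * k (q - y) ^ (2⁻¹ : ℝ) * k (q - y) ^ (2⁻¹ : ℝ) =
        f y * k (q - y) := by
      rw [mul_assoc, ← sq, ← ENNReal.rpow_natCast, Nat.cast_ofNat, hs]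
    simp only [Pi.mul_apply, ENNReal.mul_rpow_of_nonneg _ _ zero_le_two, hs, h2, one_div, hk'] at h
    calc (∫⁻ y, f y * k (q - y)) ^ 2 ≤ _ := pow_le_pow_left' h 2
      _ = _ := by
        rw [mul_pow, ← ENNReal.rpow_natCast, ← ENNReal.rpow_natCast, Nat.cast_ofNat, hs, hs,
          mul_comm]
        simp
  calc ∫⁻ q, (∫⁻ y, f y * k (q - y)) ^ 2
      ≤ ∫⁻ q, (∫⁻ y, k y) * ∫⁻ y, f y ^ 2 * k (q - y) := lintegral_mono key
    _ = (∫⁻ y, k y) * ∫⁻ y, ∫⁻ q, f y ^ 2 * k (q - y) := by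
      rw [lintegral_const_mul _ (Measurable.lintegral_prod_right'
          (f := fun z : Config d × Config d => f z.2 ^ 2 * k (z.1 - z.2)) (by fun_prop)),
        lintegral_lintegral_swap (by fun_prop)]
    _ = _ := by
      have (y : Config d) : ∫⁻ q, f y ^ 2 * k (q - y) = f y ^ 2 * ∫⁻ q, k q := by
        rw [lintegral_const_mul _ (by fun_prop), lintegral_sub_right_eq_self k y]
      simp only [this]
      rw [lintegral_mul_const _ (by fun_prop)]
      ring

/-- By `norm_fiberFourier_le` the Weyl kernel is dominated by an integrable function of `q - y`
alone, so Young's inequality applies. -/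
theorem memLp_weylOp {ε : ℝ} (hε : 0 < ε) {a : Phase d → ℝ}
    (ha : IsTame fun z => (a z : ℂ)) {ψ : Config d → ℂ} (hm : Measurable ψ)
    (hψ : Integrable fun x => ‖ψ x‖ ^ 2) : MemLp (weylOp d ε a ψ) 2 := by
  obtain ⟨C, hC⟩ := norm_fiberFourier_le hε ha
  have hop := weylOp_eq (ε := ε) ha hm hψ
  have hmeas : Measurable (weylOp d ε a ψ) := by
    rw [funext hop]
    exact (measurable_weylKernel ha
      hm).stronglyMeasurable.integral_prod_right'.measurable.const_mul _
  refine ⟨hmeas.aestronglyMeasurable, ?_⟩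
  rw [eLpNorm_lt_top_iff_lintegral_rpow_enorm_lt_top two_ne_zero ENNReal.ofNat_ne_top]
  set s : ℝ := ((2 * Real.pi * ε) ^ d)⁻¹
  set k : Config d → ℝ≥0∞ := fun v => ENNReal.ofReal (C * weight ((2 * Real.pi * ε)⁻¹ • v))
  have hk : Measurable k := by fun_prop
  have hk_fin : ∫⁻ v, k v < ⊤ :=
    ((integrable_scaled_weight (by positivity)).const_mul C).lintegral_lt_top
  have hψ_fin : ∫⁻ y, ‖ψ y‖ₑ ^ 2 < ⊤ := by
    have := hψ.lintegral_lt_top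
    simpa only [ENNReal.ofReal_pow (norm_nonneg _), ofReal_norm] using this
  have hle (q : Config d) : ‖weylOp d ε a ψ q‖ₑ ^ (2 : ℝ≥0∞).toReal ≤
      ‖(s : ℂ)‖ₑ ^ 2 * (∫⁻ y, ‖ψ y‖ₑ * k (q - y)) ^ 2 := by
    rw [hop, enorm_mul, ENNReal.toReal_ofNat, ENNReal.rpow_ofNat, mul_pow]
    gcongr
    refine (enorm_integral_le_lintegral_enorm _).trans (lintegral_mono fun y => ?_)
    rw [enorm_mul, ← ofReal_norm (fiberFourier _ _ _ _)]
    gcongr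
    exact ENNReal.ofReal_le_ofReal (hC _ _)
  refine (lintegral_mono hle).trans_lt ?_
  rw [lintegral_const_mul' _ _ (by simp)]
  refine ENNReal.mul_lt_top (by simp) ((lintegral_convolution_sq_le (by fun_prop) hk).trans_lt ?_)
  exact ENNReal.mul_lt_top (ENNReal.pow_lt_top hk_fin) hψ_fin

/-! ### Gaussians on phase space -/

theorem finrank_phase : Module.finrank ℝ (Phase d) = 2 * d := by
  rw [(WithLp.linearEquiv 2 ℝ (Config d × Config d)).finrank_eq, Module.finrank_prod]
  simp [two_mul]

/-- Gaussians decay faster than any power. -/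
theorem one_add_pow_mul_exp_le {c : ℝ} (hc : 0 < c) (n : ℕ) :
    ∃ C, ∀ r : ℝ, 0 ≤ r → (1 + r) ^ n * Real.exp (-(c * r ^ 2)) ≤ C := by
  rcases Nat.eq_zero_or_pos n with rfl | hn
  · refine ⟨1, fun r hr => ?_⟩
    simp only [pow_zero, one_mul, Real.exp_le_one_iff]
    nlinarith [sq_nonneg r]
  have hn' : (0 : ℝ) < n := by exact_mod_cast hn
  refine ⟨(2 * (1 + n / c)) ^ n, fun r hr => ?_⟩
  -- This is the `n`-th root of the desired bound, obtained from `1 + t ≤ exp t` with `t = c r²/n`;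
  -- the division is why `n = 0` is treated apart.
  have h1 : 1 + r ≤ 2 * (1 + n / c) * Real.exp (c / n * r ^ 2) := by
    have h2 := Real.add_one_le_exp (c / n * r ^ 2)
    have h3 : n / c * (c / n * r ^ 2) = r ^ 2 := by field_simp
    have h4 : 0 < n / c := by positivity
    have h5 : 0 ≤ c / n * r ^ 2 := by positivity
    calc 1 + r ≤ 2 * (1 + r ^ 2) := by nlinarith [sq_nonneg (r - 1)]
      _ ≤ 2 * ((1 + n / c) * (c / n * r ^ 2 + 1)) := by nlinarith
      _ ≤ _ := by rw [mul_assoc]; gcongr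
  calc (1 + r) ^ n * Real.exp (-(c * r ^ 2))
      ≤ (2 * (1 + n / c) * Real.exp (c / n * r ^ 2)) ^ n * Real.exp (-(c * r ^ 2)) := by gcongr
    _ = (2 * (1 + n / c)) ^ n := by
      rw [mul_pow, ← Real.exp_nat_mul, mul_assoc, ← Real.exp_add]
      have : n * (c / n * r ^ 2) + -(c * r ^ 2) = 0 := by field_simp; ring
      rw [this, Real.exp_zero, mul_one]

theorem integrable_pow_mul_exp {c : ℝ} (hc : 0 < c) (n : ℕ) :
    Integrable fun ζ : Phase d => ‖ζ‖ ^ n * Real.exp (-(c * ‖ζ‖ ^ 2)) := by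
  -- The extra power `2d + 1` exceeds the dimension `2d` of phase space, which makes the comparison
  -- function integrable.
  obtain ⟨C, hC⟩ := one_add_pow_mul_exp_le hc (n + (2 * d + 1))
  have hi : Integrable fun ζ : Phase d => (1 + ‖ζ‖) ^ (-(2 * d + 1 : ℕ) : ℝ) :=
    integrable_one_add_norm (by rw [finrank_phase]; push_cast; linarith)
  refine Integrable.mono' (hi.const_mul C) (Continuous.aestronglyMeasurable (by fun_prop))
    (Filter.Eventually.of_forall fun ζ => ?_)
  rw [Real.norm_of_nonneg (by positivity), Real.rpow_neg (by positivity), Real.rpow_natCast,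
    ← div_eq_mul_inv, le_div_iff₀ (by positivity)]
  refine le_trans ?_ (hC ‖ζ‖ (norm_nonneg _))
  rw [pow_add _ n, mul_right_comm]
  gcongr
  linarith

/-- The Wigner function of the Gaussian `g₀`. -/
def gaussianWigner (ε : ℝ) (z : Phase d) : ℝ :=
  ((Real.pi * ε) ^ d)⁻¹ * Real.exp (-(ε⁻¹ * ‖z‖ ^ 2))

/-- With `t = πε`, the factors are the Wigner prefactor, the two normalizations of `g₀`, and the
Gaussian integral over `y`. -/
theorem wigner_gaussian_constant {t : ℝ} (ht : 0 < t) (d : ℕ) :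
    ((2 * t) ^ d)⁻¹ * (t ^ (-(d : ℝ) / 4) * t ^ (-(d : ℝ) / 4)) * (4 * t) ^ ((d : ℝ) / 2) =
      (t ^ d)⁻¹ := by
  have h4 : (4 : ℝ) ^ ((d : ℝ) / 2) = 2 ^ d := by
    rw [show (4 : ℝ) = 2 ^ (2 : ℝ) by norm_num, ← Real.rpow_mul (by norm_num),
      mul_div_cancel₀ _ (by norm_num), Real.rpow_natCast]
  rw [Real.mul_rpow (by norm_num) ht.le, h4, mul_pow, mul_inv, ← Real.rpow_add ht]
  have h5 : t ^ (-(d : ℝ) / 4 + -(d : ℝ) / 4) * t ^ ((d : ℝ) / 2) = 1 := by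
    rw [← Real.rpow_add ht, show -(d : ℝ) / 4 + -(d : ℝ) / 4 + d / 2 = 0 by ring, Real.rpow_zero]
  calc _ = (2 ^ d : ℝ)⁻¹ * 2 ^ d * (t ^ d)⁻¹ *
        (t ^ (-(d : ℝ) / 4 + -(d : ℝ) / 4) * t ^ ((d : ℝ) / 2)) := by ring
    _ = _ := by rw [h5, inv_mul_cancel₀ (by positivity), one_mul, mul_one]

theorem wigner_gaussianZero {ε : ℝ} (hε : 0 < ε) (z : Phase d) :
    wigner d ε (gaussianZero d ε) z = gaussianWigner ε z := by
  have hpi := Real.pi_pos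
  have hεc : (ε : ℂ) ≠ 0 := by exact_mod_cast hε.ne'
  apply Complex.ofReal_injective
  rw [ofReal_wigner, wignerIntegral]
  set κ : ℝ := (Real.pi * ε) ^ (-(d : ℝ) / 4)
  have hint (y : Config d) :
      (starRingEnd ℂ) (gaussianZero d ε (z.fst + (2⁻¹ : ℝ) • y)) *
        gaussianZero d ε (z.fst - (2⁻¹ : ℝ) • y) *
          Complex.exp (Complex.I * ((inner ℝ y z.snd / ε : ℝ) : ℂ)) =
      ((κ * κ * Real.exp (-(ε⁻¹ * ‖z.fst‖ ^ 2)) : ℝ) : ℂ) *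
        Complex.exp (-((4 * ε)⁻¹ : ℝ) * ‖y‖ ^ 2 + (Complex.I / ε) * inner ℝ z.snd y) := by
    -- The parallelogram law separates `q` from `y` in the exponent, leaving a Gaussian Fourier
    -- integral in `y`.
    have hpar : ‖z.fst + (2⁻¹ : ℝ) • y‖ ^ 2 + ‖z.fst - (2⁻¹ : ℝ) • y‖ ^ 2 =
        2 * ‖z.fst‖ ^ 2 + 2⁻¹ * ‖y‖ ^ 2 := by
      have := parallelogram_law_with_norm ℝ z.fst ((2⁻¹ : ℝ) • y)
      rw [norm_smul, Real.norm_of_nonneg (by norm_num)] at this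
      nlinarith
    have hre : (gaussianZero d ε (z.fst + (2⁻¹ : ℝ) • y)) *
        gaussianZero d ε (z.fst - (2⁻¹ : ℝ) • y) =
        ((κ * κ * Real.exp (-(ε⁻¹ * ‖z.fst‖ ^ 2) + -((4 * ε)⁻¹ * ‖y‖ ^ 2)) : ℝ) : ℂ) := by
      rw [gaussianZero, gaussianZero, ← Complex.ofReal_mul, mul_mul_mul_comm, ← Real.exp_add]
      congr 3
      have : -(‖z.fst + (2⁻¹ : ℝ) • y‖ ^ 2 / (2 * ε)) + -(‖z.fst - (2⁻¹ : ℝ) • y‖ ^ 2 / (2 * ε)) =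
        -((‖z.fst + (2⁻¹ : ℝ) • y‖ ^ 2 + ‖z.fst - (2⁻¹ : ℝ) • y‖ ^ 2) / (2 * ε)) := by ring
      rw [this, hpar]
      field_simp
      ring
    have hconj : (starRingEnd ℂ) (gaussianZero d ε (z.fst + (2⁻¹ : ℝ) • y)) =
        gaussianZero d ε (z.fst + (2⁻¹ : ℝ) • y) := Complex.conj_ofReal _
    rw [hconj, hre, Real.exp_add, ← mul_assoc, Complex.ofReal_mul (_ * _), mul_assoc,
      Complex.ofReal_exp (-((4 * ε)⁻¹ * ‖y‖ ^ 2)), ← Complex.exp_add, real_inner_comm]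
    congr 2
    push_cast
    ring
  simp only [hint]
  rw [integral_const_mul, GaussianFourier.integral_cexp_neg_mul_sq_norm_add
    (b := (((4 * ε)⁻¹ : ℝ) : ℂ)) (by rw [Complex.ofReal_re]; positivity), finrank_euclideanSpace,
    Fintype.card_fin]
  have h1 : ((Real.pi : ℂ) / (((4 * ε)⁻¹ : ℝ) : ℂ)) ^ ((d : ℂ) / 2) =
      (((4 * (Real.pi * ε)) ^ ((d : ℝ) / 2) : ℝ) : ℂ) := by
    rw [Complex.ofReal_cpow (by positivity)]
    congr 1
    · push_cast; field_simp
    · push_cast; rfl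
  have h2 : (Complex.I / ε) ^ 2 * (‖z.snd‖ : ℂ) ^ 2 / (4 * (((4 * ε)⁻¹ : ℝ) : ℂ)) =
      ((-(ε⁻¹ * ‖z.snd‖ ^ 2) : ℝ) : ℂ) := by
    push_cast
    rw [div_pow, Complex.I_sq]
    field_simp
  rw [h1, h2, ← Complex.ofReal_exp, ← Complex.ofReal_mul, ← Complex.ofReal_mul,
    ← Complex.ofReal_mul, gaussianWigner, WithLp.prod_norm_sq_eq_of_L2,
    ← wigner_gaussian_constant (by positivity : 0 < Real.pi * ε) d, mul_add, neg_add, Real.exp_add]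
  congr 1
  simp only [← mul_assoc 2 Real.pi ε]
  ring

theorem integral_volume_sub_left {V F : Type*} [NormedAddCommGroup V] [InnerProductSpace ℝ V]
    [FiniteDimensional ℝ V] [MeasurableSpace V] [BorelSpace V] [NormedAddCommGroup F]
    [NormedSpace ℝ F] (f : V → F) (z : V) : ∫ v, f (z - v) = ∫ v, f v :=
  integral_sub_left_eq_self f volume z

theorem fourier_gaussianWigner {ε : ℝ} (hε : 0 < ε) (z ζ : Phase d) :
    𝓕 (fun w : Phase d => (gaussianWigner ε (z - w) : ℂ)) ζ =
      Complex.exp (((-2 * Real.pi * inner ℝ ζ z : ℝ) : ℂ) * Complex.I) *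
        (Real.exp (-(Real.pi ^ 2 * ε * ‖ζ‖ ^ 2)) : ℝ) := by
  have hpi := Real.pi_pos
  have hεc : (ε : ℂ) ≠ 0 := by exact_mod_cast hε.ne'
  rw [Real.fourier_eq', ← integral_volume_sub_left _ z]
  have hint (v : Phase d) : Complex.exp (((-2 * Real.pi * inner ℝ (z - v) ζ : ℝ) : ℂ) * Complex.I) •
      (gaussianWigner ε (z - (z - v)) : ℂ) =
      (Complex.exp (((-2 * Real.pi * inner ℝ ζ z : ℝ) : ℂ) * Complex.I) *
        ((((Real.pi * ε) ^ d)⁻¹ : ℝ) : ℂ)) *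
        Complex.exp (-((ε⁻¹ : ℝ) : ℂ) * ‖v‖ ^ 2 + (2 * Real.pi * Complex.I) * inner ℝ ζ v) := by
    rw [sub_sub_cancel, gaussianWigner, smul_eq_mul, inner_sub_left, real_inner_comm ζ z,
      real_inner_comm ζ v, Complex.ofReal_mul (_ ^ d)⁻¹, Complex.ofReal_exp, mul_left_comm,
      ← Complex.exp_add, mul_comm (Complex.exp _) (Complex.ofReal _),
      mul_assoc (Complex.ofReal _), ← Complex.exp_add]
    congr 2
    push_cast
    ring
  simp only [hint]
  rw [integral_const_mul, GaussianFourier.integral_cexp_neg_mul_sq_norm_add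
    (b := ((ε⁻¹ : ℝ) : ℂ)) (by rw [Complex.ofReal_re]; positivity), finrank_phase]
  have h1 : ((Real.pi : ℂ) / ((ε⁻¹ : ℝ) : ℂ)) ^ (((2 * d : ℕ) : ℂ) / 2) =
      (((Real.pi * ε) ^ d : ℝ) : ℂ) := by
    rw [show (((2 * d : ℕ) : ℂ) / 2) = d by push_cast; ring, Complex.cpow_natCast]
    push_cast
    field_simp
  have h2 : (2 * Real.pi * Complex.I) ^ 2 * (‖ζ‖ : ℂ) ^ 2 / (4 * ((ε⁻¹ : ℝ) : ℂ)) =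
      ((-(Real.pi ^ 2 * ε * ‖ζ‖ ^ 2) : ℝ) : ℂ) := by
    push_cast
    rw [mul_pow, Complex.I_sq]
    field_simp
    ring
  rw [h1, h2, ← Complex.ofReal_exp, mul_assoc, ← mul_assoc (Complex.ofReal _) (Complex.ofReal _),
    ← Complex.ofReal_mul, inv_mul_cancel₀ (by positivity), Complex.ofReal_one, one_mul]

theorem isTame_gaussianWigner {ε : ℝ} (hε : 0 < ε) (z : Phase d) :
    IsTame fun w : Phase d => (gaussianWigner ε (z - w) : ℂ) := by
  have hpi := Real.pi_pos
  refine ⟨?_, ?_, ?_⟩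
  · unfold gaussianWigner
    fun_prop
  · obtain ⟨C, hC⟩ := one_add_pow_mul_exp_le (inv_pos.2 hε) (2 * (d + 1))
    refine ⟨(1 + ‖z‖) ^ (2 * (d + 1)) * (((Real.pi * ε) ^ d)⁻¹ * C), fun x p =>
      le_mul_weight_mul_weight (norm_nonneg _) ?_⟩
    set w : Phase d := WithLp.toLp 2 (x, p)
    -- Moving the weight to the centre `z` of the Gaussian costs only a power of `1 + ‖z‖`, a
    -- constant here because `z` is fixed.
    have hw : 1 + ‖w‖ ≤ (1 + ‖z‖) * (1 + ‖z - w‖) := by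
      have h1 : ‖w‖ ≤ ‖z‖ + ‖z - w‖ := by
        have := norm_sub_le z (z - w)
        rwa [sub_sub_cancel] at this
      nlinarith [mul_nonneg (norm_nonneg z) (norm_nonneg (z - w))]
    rw [Complex.norm_real, gaussianWigner, Real.norm_of_nonneg (by positivity)]
    calc (1 + ‖w‖) ^ (2 * (d + 1)) * (((Real.pi * ε) ^ d)⁻¹ * Real.exp (-(ε⁻¹ * ‖z - w‖ ^ 2)))
        ≤ ((1 + ‖z‖) * (1 + ‖z - w‖)) ^ (2 * (d + 1)) *
          (((Real.pi * ε) ^ d)⁻¹ * Real.exp (-(ε⁻¹ * ‖z - w‖ ^ 2))) := by gcongr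
      _ = (1 + ‖z‖) ^ (2 * (d + 1)) * (((Real.pi * ε) ^ d)⁻¹ *
          ((1 + ‖z - w‖) ^ (2 * (d + 1)) * Real.exp (-(ε⁻¹ * ‖z - w‖ ^ 2)))) := by
        rw [mul_pow]; ring
      _ ≤ _ := by
        gcongr
        exact hC _ (norm_nonneg _)
  · obtain ⟨C, hC⟩ := one_add_pow_mul_exp_le (by positivity : 0 < Real.pi ^ 2 * ε) (2 * (d + 1))
    refine ⟨C, fun x p => le_mul_weight_mul_weight (norm_nonneg _) ?_⟩
    rw [fourier_gaussianWigner hε, norm_mul, Complex.norm_exp_ofReal_mul_I, one_mul,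
      Complex.norm_real, Real.norm_of_nonneg (by positivity)]
    exact hC _ (norm_nonneg _)

/-! ### Husimi function and density as Fourier transforms -/

/-- Differentiating twice along `e_i` brings down `(-2πi ⟨v, e_i⟩)²`; summing over an orthonormal
basis gives `-4π²‖v‖²`. -/
theorem laplacian_fourier {V : Type*} [NormedAddCommGroup V] [InnerProductSpace ℝ V]
    [FiniteDimensional ℝ V] [MeasurableSpace V] [BorelSpace V] {f : V → ℂ}
    (hf : ∀ n : ℕ, n ≤ 2 → Integrable fun v => ‖v‖ ^ n * ‖f v‖) (hm : AEStronglyMeasurable f)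
    (w : V) :
    Laplacian.laplacian (𝓕 f : V → ℂ) w =
      𝓕 (fun v => ((-(4 * Real.pi ^ 2 * ‖v‖ ^ 2) : ℝ) : ℂ) * f v) w := by
  have hi := VectorFourier.integrable_fourierPowSMulRight (innerSL ℝ) (hf 2 le_rfl) hm
  have hD : iteratedFDeriv ℝ 2 (𝓕 f) =
      𝓕 (fun v => VectorFourier.fourierPowSMulRight (innerSL ℝ) f v 2) :=
    Real.iteratedFDeriv_fourier (N := 2) (fun n hn => hf n (by exact_mod_cast hn)) hm le_rfl
  rw [InnerProductSpace.laplacian_eq_iteratedFDeriv_stdOrthonormalBasis]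
  simp only [hD, Real.fourier_continuousMultilinearMap_apply hi]
  simp only [Real.fourier_eq']
  rw [← integral_finsetSum]
  · congr 1; ext v
    rw [← Finset.smul_sum]
    congr 1
    simp only [VectorFourier.fourierPowSMulRight_apply, Fin.prod_univ_two, Matrix.cons_val_zero,
      Matrix.cons_val_one, innerSL_apply_apply ℝ, ← Finset.smul_sum, ← Finset.sum_smul, ← sq,
      OrthonormalBasis.sum_sq_inner_left]
    simp only [smul_eq_mul, Complex.real_smul]
    push_cast
    rw [neg_sq, mul_pow, Complex.I_sq]
    ring
  · intro i _
    have h := (ContinuousMultilinearMap.apply ℝ (fun _ : Fin 2 => V) ℂ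
      ![stdOrthonormalBasis ℝ V i, stdOrthonormalBasis ℝ V i]).integrable_comp hi
    refine h.bdd_mul (c := 1) (Continuous.aestronglyMeasurable (by fun_prop))
      (Filter.Eventually.of_forall fun v => ?_)
    rw [Complex.norm_exp_ofReal_mul_I]

/-- The function whose Fourier transform is the Husimi function of `ψ`. -/
def husimiSymbol (ε : ℝ) (ψ : Config d → ℂ) (ζ : Phase d) : ℂ :=
  (Real.exp (-(Real.pi ^ 2 * ε * ‖ζ‖ ^ 2)) : ℝ) * ambiguity ε ψ ζ

theorem measurable_husimiSymbol {ε : ℝ} {ψ : Config d → ℂ} (hm : Measurable ψ) :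
    Measurable (husimiSymbol ε ψ) :=
  Measurable.mul (Continuous.measurable (by fun_prop)) (measurable_ambiguity hm)

theorem integrable_pow_mul_norm_husimiSymbol {ε : ℝ} (hε : 0 < ε) {ψ : Config d → ℂ}
    (hm : Measurable ψ) (hψ : Integrable fun x => ‖ψ x‖ ^ 2) (n : ℕ) :
    Integrable fun ζ => ‖ζ‖ ^ n * ‖husimiSymbol ε ψ ζ‖ := by
  have hpi := Real.pi_pos
  refine Integrable.mono'
    ((integrable_pow_mul_exp (by positivity : 0 < Real.pi ^ 2 * ε) n).mul_const
    (∫ x, ‖ψ x‖ ^ 2)) (Measurable.aestronglyMeasurable ?_)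
    (Filter.Eventually.of_forall fun ζ => ?_)
  · exact (measurable_norm.pow_const n).mul (measurable_husimiSymbol hm).norm
  · rw [norm_mul, norm_pow, norm_norm, norm_norm, husimiSymbol, norm_mul, Complex.norm_real,
      Real.norm_of_nonneg (by positivity), ← mul_assoc]
    gcongr
    exact norm_ambiguity_le hψ ζ

/-- At `z`, the convolution pairs the Wigner function with a Gaussian centred at `z`. In
`weylPairing_eq` this centre appears as the phase `exp (-2πi ζ·z)`, which is the Fourier kernel. -/
theorem ofReal_husimi {ε : ℝ} (hε : 0 < ε) {ψ : Config d → ℂ}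
    (hm : Measurable ψ) (hψ : Integrable fun x => ‖ψ x‖ ^ 2) (z : Phase d) :
    (husimi d ε ψ z : ℂ) = 𝓕 (husimiSymbol ε ψ) z := by
  rw [husimi, ← integral_complex_ofReal]
  simp only [Complex.ofReal_mul, ofReal_wigner d ε ψ, wigner_gaussianZero hε]
  rw [integral_wignerIntegral_mul hε hm hψ (isTame_gaussianWigner hε z),
    weylPairing_eq hε hm hψ (isTame_gaussianWigner hε z), Real.fourier_eq']
  congr 1; ext ζ
  rw [fourier_gaussianWigner hε, husimiSymbol, smul_eq_mul, mul_assoc]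

theorem contDiff_fourier_husimiSymbol {ε : ℝ} (hε : 0 < ε) {ψ : Config d → ℂ}
    (hm : Measurable ψ) (hψ : Integrable fun x => ‖ψ x‖ ^ 2) :
    ContDiff ℝ ∞ (𝓕 (husimiSymbol ε ψ)) :=
  Real.contDiff_fourier fun n _ => integrable_pow_mul_norm_husimiSymbol hε hm hψ n

theorem contDiff_husimi {ε : ℝ} (hε : 0 < ε) {ψ : Config d → ℂ}
    (hm : Measurable ψ) (hψ : Integrable fun x => ‖ψ x‖ ^ 2) : ContDiff ℝ ∞ (husimi d ε ψ) := by
  have h : husimi d ε ψ = Complex.reCLM ∘ 𝓕 (husimiSymbol ε ψ) := by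
    ext z
    simp [← ofReal_husimi hε hm hψ]
  rw [h]
  exact Complex.reCLM.contDiff.comp (contDiff_fourier_husimiSymbol hε hm hψ)

theorem ofReal_laplacian_husimi {ε : ℝ} (hε : 0 < ε) {ψ : Config d → ℂ}
    (hm : Measurable ψ) (hψ : Integrable fun x => ‖ψ x‖ ^ 2) (z : Phase d) :
    (Laplacian.laplacian (husimi d ε ψ) z : ℂ) =
      𝓕 (fun ζ => ((-(4 * Real.pi ^ 2 * ‖ζ‖ ^ 2) : ℝ) : ℂ) * husimiSymbol ε ψ ζ) z := by
  rw [← laplacian_fourier (fun n _ => integrable_pow_mul_norm_husimiSymbol hε hm hψ n)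
    (measurable_husimiSymbol hm).aestronglyMeasurable]
  have h : 𝓕 (husimiSymbol ε ψ) = Complex.ofRealCLM ∘ husimi d ε ψ := by
    ext z
    simp [← ofReal_husimi hε hm hψ]
  have h2 : ContDiffAt ℝ 2 (husimi d ε ψ) z :=
    (contDiff_infty.1 (contDiff_husimi hε hm hψ) 2).contDiffAt
  rw [h, h2.laplacian_CLM_comp_left]
  rfl

/-- The function whose Fourier transform is the phase space density of `ψ`. -/
def muSymbol (ε : ℝ) (ψ : Config d → ℂ) (ζ : Phase d) : ℂ :=
  ((1 + Real.pi ^ 2 * ε * ‖ζ‖ ^ 2 : ℝ) : ℂ) * husimiSymbol ε ψ ζ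

theorem integrable_husimiSymbol {ε : ℝ} (hε : 0 < ε) {ψ : Config d → ℂ}
    (hm : Measurable ψ) (hψ : Integrable fun x => ‖ψ x‖ ^ 2) :
    Integrable (husimiSymbol ε ψ) := by
  rw [← integrable_norm_iff (measurable_husimiSymbol hm).aestronglyMeasurable]
  simpa using integrable_pow_mul_norm_husimiSymbol hε hm hψ 0

theorem integrable_sq_mul_husimiSymbol {ε : ℝ} (hε : 0 < ε) {ψ : Config d → ℂ}
    (hm : Measurable ψ) (hψ : Integrable fun x => ‖ψ x‖ ^ 2) (c : ℝ) :
    Integrable fun ζ => ((c * ‖ζ‖ ^ 2 : ℝ) : ℂ) * husimiSymbol ε ψ ζ := by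
  refine ((integrable_pow_mul_norm_husimiSymbol hε hm hψ 2).const_mul |c|).mono'
    (Measurable.aestronglyMeasurable ?_) (Filter.Eventually.of_forall fun ζ => ?_)
  · exact Measurable.mul (Continuous.measurable (by fun_prop)) (measurable_husimiSymbol hm)
  · rw [norm_mul, Complex.norm_real, norm_mul, norm_pow, norm_norm, Real.norm_eq_abs, mul_assoc]

theorem integrable_muSymbol {ε : ℝ} (hε : 0 < ε) {ψ : Config d → ℂ}
    (hm : Measurable ψ) (hψ : Integrable fun x => ‖ψ x‖ ^ 2) :
    Integrable (muSymbol ε ψ) := by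
  refine ((integrable_husimiSymbol hε hm hψ).add (integrable_sq_mul_husimiSymbol hε hm hψ
    (Real.pi ^ 2 * ε))).congr (Filter.Eventually.of_forall fun ζ => ?_)
  simp only [Pi.add_apply, muSymbol, Complex.ofReal_add, Complex.ofReal_one]
  ring

/-- The factor in `muSymbol` arises as `1 - (ε/4)(-4π²‖ζ‖²) = 1 + π²ε‖ζ‖²`. -/
theorem ofReal_muDensity {ε : ℝ} (hε : 0 < ε) {ψ : Config d → ℂ}
    (hm : Measurable ψ) (hψ : Integrable fun x => ‖ψ x‖ ^ 2) (z : Phase d) :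
    (muDensity d ε ψ z : ℂ) = 𝓕 (muSymbol ε ψ) z := by
  have h1 := integrable_husimiSymbol hε hm hψ
  have h2 := integrable_sq_mul_husimiSymbol hε hm hψ (-(4 * Real.pi ^ 2))
  have hphase {f : Phase d → ℂ} (hf : Integrable f) :
      Integrable fun ζ => Complex.exp (((-2 * Real.pi * inner ℝ ζ z : ℝ) : ℂ) * Complex.I) • f ζ :=
    hf.bdd_mul (c := 1) (Continuous.aestronglyMeasurable (by fun_prop))
      (Filter.Eventually.of_forall fun ζ => (Complex.norm_exp_ofReal_mul_I _).le)
  rw [muDensity, Complex.ofReal_sub, Complex.ofReal_mul, ofReal_husimi hε hm hψ,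
    ofReal_laplacian_husimi hε hm hψ]
  simp only [neg_mul] at h2
  simp only [Real.fourier_eq']
  rw [← integral_const_mul, ← integral_sub (hphase h1) ((hphase h2).const_mul _)]
  congr 1; ext ζ
  simp only [muSymbol, smul_eq_mul]
  push_cast
  ring

theorem continuous_muDensity {ε : ℝ} (hε : 0 < ε) {ψ : Config d → ℂ}
    (hm : Measurable ψ) (hψ : Integrable fun x => ‖ψ x‖ ^ 2) :
    Continuous (muDensity d ε ψ) := by
  have h : muDensity d ε ψ = Complex.re ∘ 𝓕 (muSymbol ε ψ) := by
    ext z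
    simp [← ofReal_muDensity hε hm hψ]
  rw [h]
  exact Complex.continuous_re.comp (VectorFourier.fourierIntegral_continuous
    Real.continuous_fourierChar continuous_inner (integrable_muSymbol hε hm hψ))

theorem integrable_mul_muDensity {ε : ℝ} (hε : 0 < ε) {ψ : Config d → ℂ}
    (hm : Measurable ψ) (hψ : Integrable fun x => ‖ψ x‖ ^ 2) {a : Phase d → ℝ}
    (ha : Integrable a) : Integrable fun z => a z * muDensity d ε ψ z := by
  refine ha.mul_bdd (c := ∫ ζ, ‖muSymbol ε ψ ζ‖)
    (continuous_muDensity hε hm hψ).aestronglyMeasurable (Filter.Eventually.of_forall fun z => ?_)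
  rw [← Complex.norm_real, ofReal_muDensity hε hm hψ]
  exact VectorFourier.norm_fourierIntegral_le_integral_norm _ _ _ _ _

/-- The multiplication formula `∫ a · 𝓕 g = ∫ 𝓕 a · g`, valid for integrable `a` and `g`. -/
theorem ofReal_integral_mul_muDensity {ε : ℝ} (hε : 0 < ε) {ψ : Config d → ℂ}
    (hm : Measurable ψ) (hψ : Integrable fun x => ‖ψ x‖ ^ 2) {a : Phase d → ℝ}
    (ha : Integrable a) :
    ((∫ z, a z * muDensity d ε ψ z : ℝ) : ℂ) =
      ∫ ζ, 𝓕 (fun z => (a z : ℂ)) ζ * muSymbol ε ψ ζ := by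
  rw [← integral_complex_ofReal]
  simp only [Complex.ofReal_mul, ofReal_muDensity hε hm hψ]
  have h := VectorFourier.integral_fourierIntegral_smul_eq_flip (L := innerₗ (Phase d))
    (μ := volume) (ν := volume) Real.continuous_fourierChar continuous_inner ha.ofReal
    (integrable_muSymbol hε hm hψ)
  rw [flip_innerₗ] at h
  exact h.symm

/-! ### The error estimate -/

/-- The cancellation that produces `ε²`: `1 + x ≤ exp x` makes the difference nonnegative, and `exp
(-x) ≥ 1 - x` bounds it by `1 - (1 + x)(1 - x) = x²`. -/
theorem abs_one_sub_le {x : ℝ} (hx : 0 ≤ x) : |1 - (1 + x) * Real.exp (-x)| ≤ x ^ 2 := by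
  have h1 := Real.add_one_le_exp x
  have h2 := Real.add_one_le_exp (-x)
  have h3 : (1 + x) * Real.exp (-x) ≤ 1 := by
    calc (1 + x) * Real.exp (-x) ≤ Real.exp x * Real.exp (-x) := by gcongr; linarith
      _ = 1 := by rw [← Real.exp_add, add_neg_cancel, Real.exp_zero]
  rw [abs_of_nonneg (by linarith)]
  nlinarith

theorem norm_pow_mul_fourier_le {V : Type*} [NormedAddCommGroup V] [InnerProductSpace ℝ V]
    [FiniteDimensional ℝ V] [MeasurableSpace V] [BorelSpace V] (f : 𝓢(V, ℂ)) (k : ℕ) (ζ : V) :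
    ‖ζ‖ ^ k * ‖𝓕 (f : V → ℂ) ζ‖ ≤ ∫ z, ‖iteratedFDeriv ℝ k f z‖ := by
  have hF := congrFun (Real.fourier_iteratedFDeriv (N := ⊤) (f.smooth ⊤) (fun n _ => by
    rw [← integrable_norm_iff (f.smooth n |>.continuous_iteratedFDeriv le_rfl).aestronglyMeasurable]
    simpa using f.integrable_pow_mul_iteratedFDeriv volume 0 n) (n := k) le_top) ζ
  have hle : ‖VectorFourier.fourierPowSMulRight (-innerSL ℝ) (𝓕 (f : V → ℂ)) ζ k‖ ≤
      ∫ z, ‖iteratedFDeriv ℝ k f z‖ := by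
    rw [← hF]
    exact VectorFourier.norm_fourierIntegral_le_integral_norm _ _ _ _ _
  refine le_trans ?_ hle
  rcases (pow_nonneg (norm_nonneg ζ) k).eq_or_lt with h0 | h0
  · rw [← h0, zero_mul]
    exact norm_nonneg _
  -- Evaluating the transform of the `k`-th derivative on `k` copies of `ζ` gives `(2π‖ζ‖²)^k |𝓕 f
  -- ζ|`; one factor `‖ζ‖^k` is cancelled and `(2π)^k ≥ 1` is dropped.
  have h := (VectorFourier.fourierPowSMulRight (-innerSL ℝ) (𝓕 (f : V → ℂ)) ζ k).le_opNorm
    fun _ => ζ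
  rw [VectorFourier.fourierPowSMulRight_apply] at h
  simp only [Finset.prod_const, Finset.card_univ, Fintype.card_fin, norm_smul, norm_pow, norm_neg,
    norm_mul, neg_apply, innerSL_apply_apply ℝ, real_inner_self_eq_norm_sq,
    Complex.norm_I, Complex.norm_real, norm_norm, mul_one, Complex.norm_ofNat,
    Real.norm_of_nonneg Real.pi_pos.le] at h
  have hpi : 1 ≤ (2 * Real.pi) ^ k := one_le_pow₀ (by linarith [Real.pi_gt_three])
  refine le_of_mul_le_mul_right (le_trans ?_ h) h0
  calc ‖ζ‖ ^ k * ‖𝓕 (f : V → ℂ) ζ‖ * ‖ζ‖ ^ k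
      = 1 * ((‖ζ‖ ^ 2) ^ k * ‖𝓕 (f : V → ℂ) ζ‖) := by rw [sq, mul_pow]; ring
    _ ≤ _ := by gcongr

/-- The weighted `L¹` norm of a Fourier transform is controlled by derivatives of order at
least four. -/
theorem integral_norm_pow_four_mul_fourier_le (f : 𝓢(Phase d, ℂ)) :
    ∫ ζ, ‖ζ‖ ^ 4 * ‖𝓕 (f : Phase d → ℂ) ζ‖ ≤
      (∫ ζ : Phase d, (1 + ‖ζ‖) ^ (-(2 * d + 1 : ℕ) : ℝ)) * (2 ^ (2 * d + 1) *
        (2 * ∑ k ∈ Finset.Icc 4 (2 * d + 5), ∫ z, ‖iteratedFDeriv ℝ k f z‖)) := by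
  have hi : Integrable fun ζ : Phase d => (1 + ‖ζ‖) ^ (-(2 * d + 1 : ℕ) : ℝ) :=
    integrable_one_add_norm (by rw [finrank_phase]; push_cast; linarith)
  rw [← integral_mul_const]
  refine integral_mono_of_nonneg (Filter.Eventually.of_forall fun ζ => by positivity)
    (hi.mul_const _) (Filter.Eventually.of_forall fun ζ => ?_)
  have hterm {k : ℕ} (hk : k ∈ Finset.Icc 4 (2 * d + 5)) :
      ‖ζ‖ ^ k * ‖𝓕 (f : Phase d → ℂ) ζ‖ ≤
        ∑ k ∈ Finset.Icc 4 (2 * d + 5), ∫ z, ‖iteratedFDeriv ℝ k f z‖ :=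
    (norm_pow_mul_fourier_le f k ζ).trans (Finset.single_le_sum
      (f := fun k => ∫ z, ‖iteratedFDeriv ℝ k f z‖)
      (fun k _ => integral_nonneg fun z => norm_nonneg _) hk)
  have h4 := hterm (k := 4) (by simp)
  -- `2d + 5 = 4 + (2d + 1)`: an integrable weight needs `2d + 1` powers beyond the fourth, and the
  -- two extreme orders control all of them.
  have h5 := hterm (k := 2 * d + 5) (by simp)
  dsimp only
  rw [Real.rpow_neg (by positivity), Real.rpow_natCast, ← div_eq_inv_mul,
    le_div_iff₀ (by positivity)]
  have hpow : (1 + ‖ζ‖) ^ (2 * d + 1) ≤ 2 ^ (2 * d + 1) * (1 + ‖ζ‖ ^ (2 * d + 1)) := by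
    refine (add_pow_le zero_le_one (norm_nonneg ζ) _).trans ?_
    rw [one_pow]
    gcongr
    · norm_num
    · omega
  calc ‖ζ‖ ^ 4 * ‖𝓕 (f : Phase d → ℂ) ζ‖ * (1 + ‖ζ‖) ^ (2 * d + 1)
      ≤ ‖ζ‖ ^ 4 * ‖𝓕 (f : Phase d → ℂ) ζ‖ * (2 ^ (2 * d + 1) * (1 + ‖ζ‖ ^ (2 * d + 1))) := by
        gcongr
    _ = 2 ^ (2 * d + 1) * (‖ζ‖ ^ 4 * ‖𝓕 (f : Phase d → ℂ) ζ‖ +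
        ‖ζ‖ ^ (2 * d + 5) * ‖𝓕 (f : Phase d → ℂ) ζ‖) := by ring
    _ ≤ _ := by
      rw [two_mul (Finset.sum _ _)]
      gcongr

theorem norm_weylPairing_sub_le {ε : ℝ} (hε : 0 < ε) {ψ : Config d → ℂ}
    (hm : Measurable ψ) (hψ : Integrable fun x => ‖ψ x‖ ^ 2) (f : 𝓢(Phase d, ℂ)) :
    ‖weylPairing ε ψ f - ∫ ζ, 𝓕 (f : Phase d → ℂ) ζ * muSymbol ε ψ ζ‖ ≤
      (Real.pi ^ 4 * ∫ ζ, ‖ζ‖ ^ 4 * ‖𝓕 (f : Phase d → ℂ) ζ‖) * ε ^ 2 * ∫ x, ‖ψ x‖ ^ 2 := by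
  have hf := isTame_schwartz f
  have hi1 := integrable_mul_ambiguity (ε := ε) hm hψ hf.integrable_fourier
  have hi2 : Integrable fun ζ => 𝓕 (f : Phase d → ℂ) ζ * muSymbol ε ψ ζ :=
    (integrable_muSymbol hε hm hψ).bdd_mul (c := ∫ z, ‖f z‖)
      hf.continuous_fourier.aestronglyMeasurable (Filter.Eventually.of_forall fun ζ =>
        VectorFourier.norm_fourierIntegral_le_integral_norm _ _ _ _ _)
  rw [weylPairing_eq hε hm hψ hf, ← integral_sub hi1 hi2]
  have hi4 : Integrable fun ζ => ‖ζ‖ ^ 4 * ‖𝓕 (f : Phase d → ℂ) ζ‖ :=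
    (𝓕 f).integrable_pow_mul volume 4
  have hconst : (Real.pi ^ 4 * ∫ ζ, ‖ζ‖ ^ 4 * ‖𝓕 (f : Phase d → ℂ) ζ‖) * ε ^ 2 *
      ∫ x, ‖ψ x‖ ^ 2 = ∫ ζ, (Real.pi ^ 4 * ε ^ 2 * ∫ x, ‖ψ x‖ ^ 2) *
        (‖ζ‖ ^ 4 * ‖𝓕 (f : Phase d → ℂ) ζ‖) := by
    rw [integral_const_mul]; ring
  rw [hconst]
  refine norm_integral_le_of_norm_le (hi4.const_mul _) (Filter.Eventually.of_forall fun ζ => ?_)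
  set x : ℝ := Real.pi ^ 2 * ε * ‖ζ‖ ^ 2 with hx
  have hfactor : 𝓕 (f : Phase d → ℂ) ζ * ambiguity ε ψ ζ -
      𝓕 (f : Phase d → ℂ) ζ * muSymbol ε ψ ζ =
      𝓕 (f : Phase d → ℂ) ζ * ambiguity ε ψ ζ * ((1 - (1 + x) * Real.exp (-x) : ℝ) : ℂ) := by
    rw [muSymbol, husimiSymbol, ← hx]
    push_cast
    ring
  rw [hfactor, norm_mul, norm_mul, Complex.norm_real, Real.norm_eq_abs]
  calc ‖𝓕 (f : Phase d → ℂ) ζ‖ * ‖ambiguity ε ψ ζ‖ * |1 - (1 + x) * Real.exp (-x)|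
      ≤ ‖𝓕 (f : Phase d → ℂ) ζ‖ * (∫ x, ‖ψ x‖ ^ 2) * x ^ 2 := by
        gcongr
        · exact norm_ambiguity_le hψ ζ
        · exact abs_one_sub_le (by positivity)
    _ = _ := by rw [hx]; ring

end PhaseSpace

end

open PhaseSpace FourierTransform in
theorem theorem3p2 (d : ℕ) :
    ∃ (K : ℝ) (M : ℕ), 0 ≤ K ∧
      ∀ a : 𝓢(PhaseSpace.Phase d, ℝ), ∃ C : ℝ, 0 ≤ C ∧
        C ≤ K * ∑ k ∈ Finset.Icc 4 M, ∫ z : PhaseSpace.Phase d, ‖iteratedFDeriv ℝ k a z‖ ∧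
        ∀ ε : ℝ, 0 < ε → ∀ ψ : Lp ℂ 2 (volume : Measure (PhaseSpace.Config d)),
          ContDiff ℝ ∞ (PhaseSpace.husimi d ε ψ) ∧
          Integrable (fun z : PhaseSpace.Phase d => a z * PhaseSpace.muDensity d ε ψ z) ∧
          ∃ hop : MemLp (PhaseSpace.weylOp d ε a ψ) 2 (volume : Measure (PhaseSpace.Config d)),
            ‖inner ℂ ψ (hop.toLp (PhaseSpace.weylOp d ε a ψ)) -
                ((∫ z : PhaseSpace.Phase d, a z * PhaseSpace.muDensity d ε ψ z : ℝ) : ℂ)‖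
              ≤ C * ε ^ 2 * ‖ψ‖ ^ 2 := by
  set I₀ : ℝ := ∫ ζ : Phase d, (1 + ‖ζ‖) ^ (-(2 * d + 1 : ℕ) : ℝ)
  have hI₀ : 0 ≤ I₀ := integral_nonneg fun ζ => by positivity
  -- `π⁴` comes from `x²`; the other factors and the top order are those of
  -- `integral_norm_pow_four_mul_fourier_le`.
  refine ⟨Real.pi ^ 4 * (I₀ * (2 ^ (2 * d + 1) * 2)), 2 * d + 5, by positivity, fun a => ?_⟩
  set f : 𝓢(Phase d, ℂ) := SchwartzMap.postcompCLM Complex.ofRealCLM a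
  have hfa : (f : Phase d → ℂ) = fun z => (a z : ℂ) := rfl
  -- The embedding of the reals in `ℂ` is a linear isometry, so complexifying the symbol leaves all
  -- derivative norms unchanged.
  have hderiv (k : ℕ) (z : Phase d) :
      ‖iteratedFDeriv ℝ k f z‖ = ‖iteratedFDeriv ℝ k a z‖ :=
    Complex.ofRealLI.norm_iteratedFDeriv_comp_left (a.smooth k).contDiffAt le_rfl
  refine ⟨Real.pi ^ 4 * ∫ ζ, ‖ζ‖ ^ 4 * ‖𝓕 (f : Phase d → ℂ) ζ‖,
    mul_nonneg (by positivity) (integral_nonneg fun ζ => by positivity), ?_, fun ε hε ψ => ?_⟩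
  · have h := integral_norm_pow_four_mul_fourier_le f
    simp only [hderiv] at h
    calc _ ≤ Real.pi ^ 4 * (I₀ * (2 ^ (2 * d + 1) * (2 * ∑ k ∈ Finset.Icc 4 (2 * d + 5),
          ∫ z : Phase d, ‖iteratedFDeriv ℝ k a z‖))) := by gcongr
      _ = _ := by ring
  · have hm : Measurable ψ := (Lp.stronglyMeasurable ψ).measurable
    have hψ : Integrable fun x => ‖ψ x‖ ^ 2 := (Lp.memLp ψ).integrable_norm_pow two_ne_zero
    have ha : IsTame fun z => (a z : ℂ) := hfa ▸ isTame_schwartz f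
    have hop := memLp_weylOp hε ha hm hψ
    refine ⟨contDiff_husimi hε hm hψ, integrable_mul_muDensity hε hm hψ a.integrable, hop, ?_⟩
    have hinner : inner ℂ ψ (hop.toLp (weylOp d ε a ψ)) = weylPairing ε ψ f := by
      rw [hfa, ← integral_conj_mul_weylOp hε ha hm hψ, L2.inner_def]
      refine integral_congr_ae ?_
      filter_upwards [hop.coeFn_toLp] with q hq
      rw [hq, RCLike.inner_apply, mul_comm]
    have hnorm : ‖ψ‖ ^ 2 = ∫ x, ‖ψ x‖ ^ 2 := by
      have h := L2.inner_def (𝕜 := ℂ) ψ ψ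
      simp only [inner_self_eq_norm_sq_to_K] at h
      apply Complex.ofReal_injective
      rw [← integral_complex_ofReal]
      simpa using h
    rw [hinner, hnorm, ofReal_integral_mul_muDensity hε hm hψ a.integrable]
    exact norm_weylPairing_sub_le hε hm hψ f
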